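/- Conventions. For a valued field $(F,v)$, write $vF$, $\mathcal O_F$, $\mathcal M_F$, $Fv$ for its value group (written additively), valuation ring, maximal ideal and residue field. For a subset $S$ of the value group, $(a\in F\mid va\in S)$ denotes the $\mathcal O_F$-submodule of $F$ generated by all $a\in F$ with $va\in S$. A finite extension $(L|K,v)$ is unibranched if $v$ is the only extension to $L$ of its restriction to $K$; in this case $[L:K]=\tilde p^{\,\nu}\cdot(vL:vK)\cdot[Lv:Kv]$ with an integer $\nu\ge 0$, where $\tilde p$ is the characteristic exponent of $Kv$, and $\tilde p^{\,\nu}$ is the defect. A Galois defect extension of prime degree $p$ is a unibranched valued field extension $\mathcal E=(L|K,v)$ with $L|K$ Galois of prime degree $p$ and defect $>1$ (then $p=\operatorname{char}Kv$ and $vL=vK$). For $\mathrm{id}\neq\sigma\in\operatorname{Gal}(L|K)$ put $$\Sigma_\sigma=\Big\{v\Big(\frac{\sigma b-b}{b}\Big)\;\Big|\;b\in L^\times,\ \sigma b\ne b\Big\}\subseteq vL .$$ A subgroup $H$ of $vL$ is strongly convex if it is a proper convex subgroup such that $vL/H$ has no smallest positive element. For a convex subgroup $H$, $v_H$ denotes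 the coarsening of $v$ with value group $vL/H$, and $\mathcal M_{v_H}$ the maximal ideal of its valuation ring on $L$. For $\alpha\in vL$, $\alpha>H$ means $\alpha>\beta$ for all $\beta\in H$. If $\operatorname{char}K=0$, then $(vK)_{vp}$ is the smallest convex subgroup of $vK$ containing $vp$; if $\operatorname{char}K>0$, then $(vK)_{vp}=vK$. **Theorem.** Let $\mathcal E=(L|K,v)$ be a Galois defect extension of prime degree $p$. The set $\Sigma_\sigma$ does not depend on $\sigma\ne\mathrm{id}$; denote it by $\Sigma_{\mathcal E}$, put $I_{\mathcal E}=(a\in L\mid va\in\Sigma_{\mathcal E})$, and say that $\mathcal E$ has independent defect with $H_{\mathcal E}=H$ if $H$ is a strongly convex subgroup of $vL$ with $\Sigma_{\mathcal E}=\{\alpha\in vL\mid\alpha>H\}$, and that $\mathcal E$ has independent defect if this holds for some $H$. Then $$\operatorname{Tr}_{L|K}(\mathcal M_L)=(b\in K\mid vb\in(p-1)\Sigma_{\mathcal E})=I_{\mathcal E}^{\,p-1}\cap K,$$ where $(p-1)\Sigma_{\mathcal E}=\{(p-1)\alpha\mid\alpha\in\Sigma_{\mathcal E}\}$. The extension $\mathcal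 E$ has independent defect if and only if for some strongly convex subgroup $H$ of $vL$, $$\operatorname{Tr}_{L|K}(\mathcal M_L)=\mathcal M_{v_H}\cap K=(b\in K\mid vb>H),\qquad(*)$$ where the second equality holds for every strongly convex $H$. In particular, for $H=\{0\}$ the condition $\operatorname{Tr}_{L|K}(\mathcal M_L)=\mathcal M_{v_H}\cap K$ means that $\operatorname{Tr}_{L|K}(\mathcal M_L)=\mathcal M_K$, and $\mathcal E$ has independent defect with $H_{\mathcal E}=\{0\}$ if and only if $\operatorname{Tr}_{L|K}(\mathcal M_L)=\mathcal M_K$. If $vK$ is archimedean, or more generally if $(vK)_{vp}$ is archimedean, then every strongly convex $H$ satisfying $(*)$ is $\{0\}$, and $\mathcal E$ has independent defect if and only if $\operatorname{Tr}_{L|K}(\mathcal M_L)=\mathcal M_K$. If $\operatorname{char}K=0$ (mixed characteristic), then for every strongly convex $H$ satisfying $(*)$ we have $p\in\mathcal M_{v_H}$, and the residue field $Kv_H$ has characteristic $p$. -/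

import Mathlib

/-!
Valued fields are written additively, as in Krull's notation: `v : L → Γ ∪ {∞}`, where `WithTop Γ`
is `Γ ∪ {∞}` and `Γ` is a linearly ordered abelian group.
-/

namespace DefectTrace

section ValuedField

variable {Γ : Type*} [AddCommGroup Γ] [LinearOrder Γ] [IsOrderedAddMonoid Γ]
variable {F : Type*} [Field F]

/-- The value group `wF = {w a | a ∈ F, a ≠ 0}` of the valued field `(F, w)`. -/
def valueGroup (w : AddValuation F (WithTop Γ)) : AddSubgroup Γ where
  carrier := {γ | ∃ a : F, w a = (γ : WithTop Γ)}
  zero_mem' := ⟨1, by simp⟩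
  add_mem' := by
    rintro γ δ ⟨a, ha⟩ ⟨b, hb⟩
    exact ⟨a * b, by rw [AddValuation.map_mul, ha, hb, WithTop.coe_add]⟩
  neg_mem' := by
    rintro γ ⟨a, ha⟩
    refine ⟨a⁻¹, ?_⟩
    have ha0 : a ≠ 0 := by
      rintro rfl
      rw [AddValuation.map_zero] at ha
      exact WithTop.top_ne_coe ha
    have h : w a⁻¹ + w a = 0 := by
      rw [← AddValuation.map_mul, inv_mul_cancel₀ ha0, AddValuation.map_one]
    rw [ha] at h
    cases hw : w a⁻¹ with
    | top => rw [hw] at h; simp at h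
    | coe δ =>
      rw [hw, ← WithTop.coe_add, ← WithTop.coe_zero, WithTop.coe_inj] at h
      rw [WithTop.coe_inj]
      exact eq_neg_of_add_eq_zero_left h

/-- For a subgroup `H` of `Γ`: the ring `{a ∈ F | w a ≥ h for some h ∈ H}`. If `H` is convex this is
the valuation ring of the coarsening `w_H : F → (Γ/H) ∪ {∞}`, `w_H a = w a + H`; indeed
`w a + H ≥ 0` in `Γ/H` if and only if `w a ≥ h` for some `h ∈ H`. -/
def coarsening (w : AddValuation F (WithTop Γ)) (H : AddSubgroup Γ) : ValuationSubring F where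
  carrier := {a | ∃ h ∈ H, (h : WithTop Γ) ≤ w a}
  mul_mem' := by
    rintro a b ⟨h, hh, ha⟩ ⟨k, hk, hb⟩
    refine ⟨h + k, H.add_mem hh hk, ?_⟩
    rw [AddValuation.map_mul, WithTop.coe_add]
    exact add_le_add ha hb
  one_mem' := ⟨0, H.zero_mem, by simp⟩
  add_mem' := by
    rintro a b ⟨h, hh, ha⟩ ⟨k, hk, hb⟩
    rcases le_total h k with hhk | hhk
    · exact ⟨h, hh, AddValuation.map_le_add w ha ((WithTop.coe_le_coe.2 hhk).trans hb)⟩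
    · exact ⟨k, hk, AddValuation.map_le_add w ((WithTop.coe_le_coe.2 hhk).trans ha) hb⟩
  zero_mem' := ⟨0, H.zero_mem, by simp⟩
  neg_mem' := by
    rintro a ⟨h, hh, ha⟩
    exact ⟨h, hh, by rwa [AddValuation.map_neg]⟩
  mem_or_inv_mem' := by
    intro a
    by_cases ha0 : a = 0
    · subst ha0
      exact Or.inl ⟨0, H.zero_mem, by simp⟩
    have h : w a + w a⁻¹ = 0 := by
      rw [← AddValuation.map_mul, mul_inv_cancel₀ ha0, AddValuation.map_one]
    rcases le_total 0 (w a) with h0 | h0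
    · exact Or.inl ⟨0, H.zero_mem, by simpa using h0⟩
    · refine Or.inr ⟨0, H.zero_mem, ?_⟩
      have : w a + w a⁻¹ ≤ 0 + w a⁻¹ := add_le_add_left h0 _
      rw [h, zero_add] at this
      simpa using this

/-- The valuation ring `𝒪_F = {a ∈ F | w a ≥ 0}`. -/
def valRing (w : AddValuation F (WithTop Γ)) : ValuationSubring F where
  carrier := {a | 0 ≤ w a}
  mul_mem' := by
    intro a b (ha : 0 ≤ w a) (hb : 0 ≤ w b)
    change 0 ≤ w (a * b)
    rw [AddValuation.map_mul]
    exact add_nonneg ha hb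
  one_mem' := by simp
  add_mem' := fun ha hb => AddValuation.map_le_add w ha hb
  zero_mem' := by simp
  neg_mem' := by
    intro a (ha : 0 ≤ w a)
    change 0 ≤ w (-a)
    rwa [AddValuation.map_neg]
  mem_or_inv_mem' := by
    intro a
    rcases (coarsening w ⊥).mem_or_inv_mem a with ⟨h, hh, ha⟩ | ⟨h, hh, ha⟩
    · rw [AddSubgroup.mem_bot] at hh
      subst hh
      exact Or.inl ha
    · rw [AddSubgroup.mem_bot] at hh
      subst hh
      exact Or.inr ha

/-- The maximal ideal of a valuation ring `A` of `F`, as a subset of `F`. -/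
def maxIdeal (A : ValuationSubring F) : Set F :=
  Subtype.val '' (IsLocalRing.maximalIdeal A : Set A)

/-- For `S ⊆ Γ`, the `𝒪_F`-submodule `(a ∈ F | w a ∈ S)` of `F` generated by all `a ∈ F` with
`w a ∈ S`. -/
def spanOfValues (w : AddValuation F (WithTop Γ)) (S : Set Γ) : Submodule (valRing w) F :=
  Submodule.span (valRing w) {a : F | ∃ γ ∈ S, w a = (γ : WithTop Γ)}

/-- `{α | α > H}`: the set of all elements that are larger than every element of `H`. -/
def above (H : AddSubgroup Γ) : Set Γ := {α | ∀ β ∈ H, β < α}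

/-- A strongly convex subgroup `H` of `Γ`: a proper convex subgroup such that `Γ/H` has no smallest
positive element. A coset `α + H` is positive in `Γ/H` if and only if `α > H`, and
`α + H ≤ β + H` if and only if `α ≤ β + h` for some `h ∈ H`. -/
structure IsStronglyConvex (H : AddSubgroup Γ) : Prop where
  proper : H ≠ ⊤
  convex : (H : Set Γ).OrdConnected
  no_least : ¬ ∃ α ∈ above H, ∀ β ∈ above H, ∃ h ∈ H, α ≤ β + h

/-- For `char F = 0`, the smallest convex subgroup of the value group `wF` that contains `w p`;
for `char F > 0`, the whole value group `wF`. -/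
noncomputable def convexHullOfValue (w : AddValuation F (WithTop Γ)) (p : ℕ) :
    AddSubgroup (valueGroup w) :=
  open scoped Classical in
  if ringChar F = 0 then
    sInf {C : AddSubgroup (valueGroup w) | (C : Set (valueGroup w)).OrdConnected ∧
      ∀ γ : valueGroup w, w (p : F) = ((γ : Γ) : WithTop Γ) → γ ∈ C}
  else ⊤

end ValuedField

section Extension

variable {Γ : Type*} [AddCommGroup Γ] [LinearOrder Γ] [IsOrderedAddMonoid Γ]
variable (K : Type*) {L : Type*} [Field K] [Field L] [Algebra K L]

/-- The restriction of `v` to the subfield `K` of `L`. -/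
def restrict (v : AddValuation L (WithTop Γ)) : AddValuation K (WithTop Γ) :=
  v.comap (algebraMap K L)

/-- The inclusion `𝒪_K → 𝒪_L`. -/
def valRingMap (v : AddValuation L (WithTop Γ)) : valRing (restrict K v) →+* valRing v where
  toFun a := ⟨algebraMap K L a.1, a.2⟩
  map_one' := Subtype.ext (map_one _)
  map_mul' _ _ := Subtype.ext (map_mul _ _ _)
  map_zero' := Subtype.ext (map_zero _)
  map_add' _ _ := Subtype.ext (map_add _ _ _)

instance isLocalHom_valRingMap (v : AddValuation L (WithTop Γ)) :
    IsLocalHom (valRingMap K v) where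
  map_nonunit := by
    intro a ha
    obtain ⟨b, hb⟩ := ha.exists_right_inv
    have hb' : algebraMap K L a.1 * b.1 = 1 := congrArg Subtype.val hb
    have ha0 : a.1 ≠ 0 := by
      intro h
      rw [h, map_zero, zero_mul] at hb'
      exact zero_ne_one hb'
    have hbinv : algebraMap K L (a.1)⁻¹ = b.1 := by
      rw [map_inv₀]
      exact inv_eq_of_mul_eq_one_right hb'
    have hmem : (a.1)⁻¹ ∈ valRing (restrict K v) := by
      change 0 ≤ v (algebraMap K L (a.1)⁻¹)
      rw [hbinv]
      exact b.2
    exact IsUnit.of_mul_eq_one ⟨(a.1)⁻¹, hmem⟩ (Subtype.ext (mul_inv_cancel₀ ha0))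

/-- The residue field `Fv = 𝒪_F/ℳ_F` of a valuation ring. -/
abbrev residueField {F : Type*} [Field F] (A : ValuationSubring F) : Type _ :=
  IsLocalRing.ResidueField A

/-- The residue degree `[Lv : Kv]`, for the embedding `Kv → Lv` induced by `𝒪_K → 𝒪_L`. -/
noncomputable def residueDegree (v : AddValuation L (WithTop Γ)) : ℕ :=
  letI : Algebra (residueField (valRing (restrict K v))) (residueField (valRing v)) :=
    (IsLocalRing.ResidueField.map (valRingMap K v)).toAlgebra
  Module.finrank (residueField (valRing (restrict K v))) (residueField (valRing v))

/-- The index `(vL : vK)` of value groups. -/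
noncomputable def ramificationIndex (v : AddValuation L (WithTop Γ)) : ℕ :=
  (valueGroup (restrict K v)).relIndex (valueGroup v)

/-- `(L|K, v)` is unibranched: `v` is, up to equivalence, the only extension to `L` of its
restriction to `K`, that is, `𝒪_L` is the only valuation ring of `L` lying over `𝒪_K`. -/
def IsUnibranched (v : AddValuation L (WithTop Γ)) : Prop :=
  ∀ B : ValuationSubring L, B.comap (algebraMap K L) = valRing (restrict K v) → B = valRing v

/-- `(L|K, v)` has defect `d`: `d` is a power of the characteristic exponent of `Kv` and
`[L : K] = d · (vL : vK) · [Lv : Kv]`. -/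
def HasDefect (v : AddValuation L (WithTop Γ)) (d : ℕ) : Prop :=
  (∃ ν : ℕ, d = ringExpChar (residueField (valRing (restrict K v))) ^ ν) ∧
    Module.finrank K L = d * ramificationIndex K v * residueDegree K v

/-- `(L|K, v)` is a (unibranched) Galois defect extension of prime degree `p`. -/
structure IsGaloisDefectExtension (v : AddValuation L (WithTop Γ)) (p : ℕ) : Prop where
  prime : p.Prime
  finrank_eq : Module.finrank K L = p
  isGalois : IsGalois K L
  unibranched : IsUnibranched K v
  defect : ∃ d : ℕ, HasDefect K v d ∧ 1 < d

variable {K} in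
/-- `Σ_σ = {v((σ b - b)/b) | b ∈ L, b ≠ 0, σ b ≠ b}`, as a set of elements of `Γ` (the value `∞`,
taken when `σ b = b`, is not an element of `Γ`). -/
def sigmaSet (v : AddValuation L (WithTop Γ)) (σ : L ≃ₐ[K] L) : Set Γ :=
  {γ | ∃ b : L, b ≠ 0 ∧ v ((σ b - b) / b) = (γ : WithTop Γ)}

/-- `Σ_ℰ`, the common value of the sets `Σ_σ` for `σ ≠ id` in the Galois group. It is formed as
their union, which is each single `Σ_σ` when these sets all agree. -/
def SigmaE (v : AddValuation L (WithTop Γ)) : Set Γ :=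
  ⋃ σ ∈ {σ : L ≃ₐ[K] L | σ ≠ 1}, sigmaSet v σ

/-- The ramification ideal `I_ℰ = (a ∈ L | v a ∈ Σ_ℰ)`. -/
def ramificationIdeal (v : AddValuation L (WithTop Γ)) : Submodule (valRing v) L :=
  spanOfValues v (SigmaE K v)

/-- `ℰ` has independent defect with `H_ℰ = H`: the subgroup `H` of `vL = Γ` is strongly convex and
`Σ_ℰ = {α ∈ vL | α > H}`. -/
def HasIndependentDefectWith (v : AddValuation L (WithTop Γ)) (H : AddSubgroup Γ) : Prop :=
  IsStronglyConvex H ∧ SigmaE K v = above H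

/-- `ℰ` has independent defect. -/
def HasIndependentDefect (v : AddValuation L (WithTop Γ)) : Prop :=
  ∃ H : AddSubgroup Γ, HasIndependentDefectWith K v H

/-- `Tr_{L|K}(ℳ_L)`. -/
def traceMax (v : AddValuation L (WithTop Γ)) : Set K :=
  (fun a => Algebra.trace K L a) '' maxIdeal (valRing v)

/-- `ℳ_{v_H} ∩ K`, where `ℳ_{v_H}` is the maximal ideal of the valuation ring of `v_H` on `L`. -/
def coarseMaxInter (v : AddValuation L (WithTop Γ)) (H : AddSubgroup Γ) : Set K :=
  algebraMap K L ⁻¹' maxIdeal (coarsening v H)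

end Extension

end DefectTrace

/-! Since `p` is prime and the defect exceeds 1, the defect is `p`, so value group and residue field
do not grow: every `b ≠ 0` in `L` has a `c ∈ K` with `v (b - c) > v b`. Unibranchedness gives `v ∘ σ
= v`. Put `D = σ - 1`, so that `Σ_ℰ` consists of the differences `v (D b) - v b` with `D b ≠ 0`. As
`D` kills `K`, translating `b` by elements of `K` changes `v b` but not `D b`; hence `Σ_ℰ` is
positive, closed upwards and without least element.

The trace formula amounts to `Tr(ℳ_L) = {b | v b ≥ (p-1)γ for some γ ∈ Σ_ℰ}` (`mem_traceMax_iff`).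
For `⊆`, expand `Tr = ((1 + D)^p - 1)/D = p + ⋯ + D^(p-1)`: each `D` raises values by an element of
`Σ_ℰ`, the other coefficients are divisible by `p`, and `v p ≥ (p-1)γ` for some `γ ∈ Σ_ℰ`
(`exists_nsmul_le_val_natCast`), as one sees on an element `D c` of trace zero. For `⊇`, Euler's
formula gives elements of trace 1 and value `-(p-1)γ` (`exists_trace_eq_one`), which are then
multiplied by elements of `K`.

Independent defect is thereby compared with `(*)` by passing between `α` and `(p-1)α`. This
preserves being `> H`, and strong convexity makes every element `> H` dominate `(p-1)α` for some `α
> H`. The bound on `v p` also gives `v p > H`, hence the archimedean and mixed characteristic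
statements. -/

namespace DefectTrace

/-! ### Values, maximal ideals of coarsenings, and modules generated by values -/

section Values

variable {Γ : Type*} [AddCommGroup Γ] [LinearOrder Γ] [IsOrderedAddMonoid Γ]
variable {F : Type*} [Field F] (w : AddValuation F (WithTop Γ))

theorem exists_coe_eq_of_ne_zero {a : F} (ha : a ≠ 0) : ∃ γ : Γ, w a = γ := by
  have h : w a ≠ ⊤ := (AddValuation.ne_top_iff w).2 ha
  exact ⟨(w a).untop h, (WithTop.coe_untop _ h).symm⟩

theorem ne_zero_of_eq_coe {a : F} {γ : Γ} (h : w a = γ) : a ≠ 0 := by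
  rintro rfl
  rw [AddValuation.map_zero] at h
  exact WithTop.top_ne_coe h

theorem val_inv_eq {a : F} {γ : Γ} (h : w a = γ) : w a⁻¹ = ((-γ : Γ) : WithTop Γ) := by
  have ha := ne_zero_of_eq_coe w h
  obtain ⟨δ, hδ⟩ := exists_coe_eq_of_ne_zero w (inv_ne_zero ha)
  have h1 : w a + w a⁻¹ = 0 := by
    rw [← AddValuation.map_mul, mul_inv_cancel₀ ha, AddValuation.map_one]
  rw [h, hδ, ← WithTop.coe_add, ← WithTop.coe_zero, WithTop.coe_inj] at h1
  rw [hδ, neg_eq_of_add_eq_zero_right h1]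

theorem val_div_eq {a b : F} {γ δ : Γ} (ha : w a = γ) (hb : w b = δ) :
    w (a / b) = ((γ - δ : Γ) : WithTop Γ) := by
  rw [div_eq_mul_inv, AddValuation.map_mul, ha, val_inv_eq w hb, ← WithTop.coe_add, sub_eq_add_neg]

theorem zero_le_val_div {a b : F} (hb : b ≠ 0) (h : w b ≤ w a) : 0 ≤ w (a / b) := by
  by_cases ha : a = 0
  · simp [ha]
  obtain ⟨α, hα⟩ := exists_coe_eq_of_ne_zero w ha
  obtain ⟨β, hβ⟩ := exists_coe_eq_of_ne_zero w hb
  rw [hα, hβ, WithTop.coe_le_coe] at h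
  rw [val_div_eq w hα hβ, ← WithTop.coe_zero, WithTop.coe_le_coe]
  exact sub_nonneg.2 h

theorem val_pow_eq {a : F} {γ : Γ} (h : w a = γ) (n : ℕ) :
    w (a ^ n) = ((n • γ : Γ) : WithTop Γ) := by
  rw [AddValuation.map_pow, h, WithTop.coe_nsmul]

theorem zero_le_val_natCast (n : ℕ) : 0 ≤ w (n : F) := (natCast_mem (valRing w) n : _)

/-- An element of the coarsened ring is a unit exactly when its value is also bounded above by an
element of `H`. -/
theorem mem_maxIdeal_coarsening {H : AddSubgroup Γ} {a : F} :
    a ∈ maxIdeal (coarsening w H) ↔ ∀ h ∈ H, (h : WithTop Γ) < w a := by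
  constructor
  · rintro ⟨⟨b, hb⟩, hbm, rfl⟩ h hh
    by_contra! hle
    refine (IsLocalRing.mem_maximalIdeal _).1 hbm ?_
    obtain ⟨β, hβ⟩ : ∃ β : Γ, w b = β :=
      ⟨(w b).untop (ne_top_of_le_ne_top WithTop.coe_ne_top hle), (WithTop.coe_untop _ _).symm⟩
    have hβh : β ≤ h := by
      have hle' : w b ≤ h := hle
      rwa [hβ, WithTop.coe_le_coe] at hle'
    refine IsUnit.of_mul_eq_one ⟨b⁻¹, -h, H.neg_mem hh, ?_⟩
      (Subtype.ext (mul_inv_cancel₀ (ne_zero_of_eq_coe w hβ)))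
    rw [val_inv_eq w hβ, WithTop.coe_le_coe]
    exact neg_le_neg hβh
  · intro h
    have ha : a ∈ coarsening w H := ⟨0, H.zero_mem, (h 0 H.zero_mem).le⟩
    refine ⟨⟨a, ha⟩, (IsLocalRing.mem_maximalIdeal _).2 fun hu => ?_, rfl⟩
    obtain ⟨⟨b, k, hk, hb⟩, hab⟩ := hu.exists_right_inv
    have hab' : a * b = 1 := congrArg Subtype.val hab
    have h1 : w a + w b = 0 := by rw [← AddValuation.map_mul, hab', AddValuation.map_one]
    obtain ⟨α, hα⟩ := exists_coe_eq_of_ne_zero w (left_ne_zero_of_mul_eq_one hab')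
    obtain ⟨β, hβ⟩ := exists_coe_eq_of_ne_zero w (right_ne_zero_of_mul_eq_one hab')
    have h2 := h (-k) (H.neg_mem hk)
    rw [hα, WithTop.coe_lt_coe] at h2
    rw [hβ, WithTop.coe_le_coe] at hb
    rw [hα, hβ, ← WithTop.coe_add, ← WithTop.coe_zero, WithTop.coe_inj] at h1
    have h3 : 0 < α + β := by simpa using add_lt_add_of_lt_of_le h2 hb
    exact h3.ne' h1

theorem mem_coarsening_bot {a : F} : a ∈ coarsening w ⊥ ↔ 0 ≤ w a := by
  constructor
  · rintro ⟨h, hh, ha⟩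
    rw [AddSubgroup.mem_bot] at hh
    subst hh
    exact ha
  · exact fun ha => ⟨0, AddSubgroup.zero_mem _, ha⟩

theorem coarsening_bot : coarsening w ⊥ = valRing w :=
  SetLike.ext fun _ => mem_coarsening_bot w

theorem mem_maxIdeal_valRing {a : F} : a ∈ maxIdeal (valRing w) ↔ 0 < w a := by
  rw [← coarsening_bot, mem_maxIdeal_coarsening]
  simp

/-- Over a valuation ring, `a` is a multiple of `b` as soon as `w a ≥ w b`; `hSw` supplies such a
`b` for each value in `S`, and `hS` is needed for `a = 0`. -/
theorem mem_spanOfValues {S : Set Γ} (hS : S.Nonempty) (hSw : S ⊆ valueGroup w) {a : F} :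
    a ∈ spanOfValues w S ↔ ∃ γ ∈ S, (γ : WithTop Γ) ≤ w a := by
  constructor
  · intro ha
    refine Submodule.span_induction ?_ ?_ ?_ ?_ ha
    · rintro x ⟨γ, hγ, hx⟩
      exact ⟨γ, hγ, hx.ge⟩
    · obtain ⟨γ, hγ⟩ := hS
      exact ⟨γ, hγ, by simp⟩
    · rintro x y - - ⟨γ, hγ, hx⟩ ⟨δ, hδ, hy⟩
      rcases le_total γ δ with h | h
      · exact ⟨γ, hγ, AddValuation.map_le_add w hx ((WithTop.coe_le_coe.2 h).trans hy)⟩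
      · exact ⟨δ, hδ, AddValuation.map_le_add w ((WithTop.coe_le_coe.2 h).trans hx) hy⟩
    · rintro ⟨r, hr⟩ x - ⟨γ, hγ, hx⟩
      refine ⟨γ, hγ, ?_⟩
      change _ ≤ w (r * x)
      rw [AddValuation.map_mul]
      exact hx.trans (le_add_of_nonneg_left hr)
  · rintro ⟨γ, hγ, ha⟩
    obtain ⟨b, hb⟩ := hSw hγ
    have hb0 := ne_zero_of_eq_coe w hb
    have hr : a / b ∈ valRing w := zero_le_val_div w hb0 (hb.trans_le ha)
    have : a = (⟨a / b, hr⟩ : valRing w) • b := (div_mul_cancel₀ a hb0).symm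
    rw [this]
    exact Submodule.smul_mem _ _ (Submodule.subset_span ⟨γ, hγ, hb⟩)

/-- A product of elements bounded below by different values of `S` is controlled by the smallest of
these values, so a single `γ` suffices. -/
theorem le_val_of_mem_spanOfValues_pow {S : Set Γ} (hS : S.Nonempty) (hSw : S ⊆ valueGroup w)
    (n : ℕ) {a : F} (ha : a ∈ spanOfValues w S ^ n) :
    ∃ γ ∈ S, ((n • γ : Γ) : WithTop Γ) ≤ w a := by
  induction n generalizing a with
  | zero =>
    obtain ⟨γ, hγ⟩ := hS
    rw [pow_zero] at ha
    obtain ⟨r, rfl⟩ := Submodule.mem_one.1 ha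
    refine ⟨γ, hγ, ?_⟩
    rw [zero_nsmul]
    exact r.2
  | succ n ih =>
    rw [pow_succ] at ha
    refine Submodule.mul_induction_on ha ?_ ?_
    · intro x hx y hy
      obtain ⟨γ, hγ, hx⟩ := ih hx
      obtain ⟨δ, hδ, hy⟩ := (mem_spanOfValues w hS hSw).1 hy
      have key : ∀ ε : Γ, ε ≤ γ → ε ≤ δ → (((n + 1) • ε : Γ) : WithTop Γ) ≤ w (x * y) := by
        intro ε h1 h2
        rw [AddValuation.map_mul, succ_nsmul, WithTop.coe_add]
        exact add_le_add ((WithTop.coe_le_coe.2 (nsmul_le_nsmul_right h1 n)).trans hx)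
          ((WithTop.coe_le_coe.2 h2).trans hy)
      rcases le_total γ δ with h | h
      · exact ⟨γ, hγ, key γ le_rfl h⟩
      · exact ⟨δ, hδ, key δ h le_rfl⟩
    · rintro x y ⟨γ, hγ, hx⟩ ⟨δ, hδ, hy⟩
      rcases le_total γ δ with h | h
      · exact ⟨γ, hγ, AddValuation.map_le_add w hx
          ((WithTop.coe_le_coe.2 (nsmul_le_nsmul_right h _)).trans hy)⟩
      · exact ⟨δ, hδ, AddValuation.map_le_add w
          ((WithTop.coe_le_coe.2 (nsmul_le_nsmul_right h _)).trans hx) hy⟩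

theorem mem_spanOfValues_pow {S : Set Γ} (hS : S.Nonempty) (hSw : S ⊆ valueGroup w)
    (n : ℕ) {a : F} :
    a ∈ spanOfValues w S ^ n ↔ ∃ γ ∈ S, ((n • γ : Γ) : WithTop Γ) ≤ w a := by
  refine ⟨le_val_of_mem_spanOfValues_pow w hS hSw n, ?_⟩
  rintro ⟨γ, hγ, ha⟩
  obtain ⟨b, hb⟩ := hSw hγ
  have hb0 := pow_ne_zero n (ne_zero_of_eq_coe w hb)
  have hr : a / b ^ n ∈ valRing w := zero_le_val_div w hb0 ((val_pow_eq w hb n).trans_le ha)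
  have hbS : b ∈ spanOfValues w S := Submodule.subset_span ⟨γ, hγ, hb⟩
  have : a = (⟨a / b ^ n, hr⟩ : valRing w) • b ^ n := (div_mul_cancel₀ a hb0).symm
  rw [this]
  exact Submodule.smul_mem _ _ (Submodule.pow_mem_pow _ hbS n)

end Values

/-! ### Convex subgroups and the elements above them -/

section Convex

variable {Γ : Type*} [AddCommGroup Γ] [LinearOrder Γ] {H : AddSubgroup Γ}

theorem zero_lt_of_mem_above {α : Γ} (hα : α ∈ above H) : 0 < α := hα 0 H.zero_mem

theorem above_of_le {α β : Γ} (hα : α ∈ above H) (h : α ≤ β) : β ∈ above H :=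
  fun γ hγ => (hα γ hγ).trans_le h

theorem mem_of_le_of_le (hH : (H : Set Γ).OrdConnected) {α β : Γ} (hβ : β ∈ H) (h0 : 0 ≤ α)
    (h : α ≤ β) : α ∈ H :=
  hH.out H.zero_mem hβ ⟨h0, h⟩

theorem mem_above_of_pos_of_notMem (hH : (H : Set Γ).OrdConnected) {α : Γ} (h0 : 0 ≤ α)
    (h : α ∉ H) : α ∈ above H := by
  intro β hβ
  by_contra! hle
  exact h (mem_of_le_of_le hH hβ h0 hle)

variable [IsOrderedAddMonoid Γ]

theorem nsmul_mem_above {α : Γ} (hα : α ∈ above H) {n : ℕ} (hn : n ≠ 0) : n • α ∈ above H :=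
  above_of_le hα (le_self_nsmul (zero_lt_of_mem_above hα).le hn)

theorem mem_above_of_nsmul_mem {α : Γ} {n : ℕ} (h : n • α ∈ above H) : α ∈ above H := by
  intro β hβ
  by_contra! hle
  exact (h _ (H.nsmul_mem hβ n)).not_ge (nsmul_le_nsmul_right hle n)

theorem IsStronglyConvex.above_nonempty (hH : IsStronglyConvex H) : (above H).Nonempty := by
  obtain ⟨α, hα⟩ : ∃ α, α ∉ H := by
    by_contra! h
    exact hH.proper (eq_top_iff.2 fun α _ => h α)
  rcases le_total 0 α with h | h
  · exact ⟨α, mem_above_of_pos_of_notMem hH.convex h hα⟩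
  · exact ⟨-α, mem_above_of_pos_of_notMem hH.convex (neg_nonneg.2 h) (by simpa using hα)⟩

/-- The absence of a smallest positive element of `Γ/H` splits `β` as `γ + (β - γ)` with both
summands above `H`. Induction bounds `n • α` by `γ`, and the smaller of `α` and `β - γ` serves for
`n + 1`. -/
theorem IsStronglyConvex.exists_nsmul_le (hH : IsStronglyConvex H) (n : ℕ) {β : Γ}
    (hβ : β ∈ above H) : ∃ α ∈ above H, n • α ≤ β := by
  induction n generalizing β with
  | zero => exact ⟨β, hβ, by simpa using (zero_lt_of_mem_above hβ).le⟩
  | succ n ih =>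
    have h := hH.no_least
    push Not at h
    obtain ⟨γ, hγ, hlt⟩ := h β hβ
    have hd : β - γ ∈ above H := fun k hk => by
      have := hlt k hk
      rwa [lt_sub_iff_add_lt, add_comm]
    obtain ⟨α, hα, hle⟩ := ih hγ
    rcases le_total α (β - γ) with h | h
    · refine ⟨α, hα, ?_⟩
      rw [succ_nsmul]
      simpa using add_le_add hle h
    · refine ⟨β - γ, hd, ?_⟩
      rw [succ_nsmul]
      simpa using add_le_add ((nsmul_le_nsmul_right h n).trans hle) (le_refl (β - γ))

end Convex

/-! ### The trace of a cyclic extension of prime degree -/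

section Trace

variable {K L : Type*} [Field K] [Field L] [Algebra K L]

/-- The operator `σ - 1` on `L`. -/
noncomputable def differenceOp (σ : L ≃ₐ[K] L) : Module.End K L :=
  σ.toLinearMap - 1

theorem differenceOp_apply (σ : L ≃ₐ[K] L) (x : L) : differenceOp σ x = σ x - x := rfl

theorem toLinearMap_pow_apply (σ : L ≃ₐ[K] L) (n : ℕ) (x : L) :
    ((σ.toLinearMap : Module.End K L) ^ n) x = (σ ^ n) x := by
  induction n generalizing x with
  | zero => simp
  | succ n ih =>
    rw [pow_succ, pow_succ, Module.End.mul_apply, ih]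
    rfl

/-- This is the polynomial identity `((X + 1)^n - 1)/X = ∑ (n choose k+1) X^k`, evaluated at `σ -
1`. -/
theorem sum_pow_eq_sum_choose_mul_differenceOp (σ : L ≃ₐ[K] L) (n : ℕ) (x : L) :
    ∑ i ∈ Finset.range n, (σ ^ i) x =
      ∑ k ∈ Finset.range n, (n.choose (k + 1) : L) * (differenceOp σ ^ k) x := by
  have h := congrArg (fun q => Polynomial.aeval (differenceOp σ) q x)
    (Polynomial.geom_sum_X_comp_X_add_one_eq_sum (R := K) n)
  have hσ : differenceOp σ + 1 = σ.toLinearMap := sub_add_cancel _ _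
  simp only [Polynomial.aeval_comp, map_sum, map_pow, Polynomial.aeval_X, map_add, map_one, hσ,
    map_mul, map_natCast, LinearMap.sum_apply, toLinearMap_pow_apply] at h
  rw [h]
  refine Finset.sum_congr rfl fun k _ => ?_
  rw [← nsmul_eq_mul, ← nsmul_eq_mul]
  simp

variable {p : ℕ} (hp : p.Prime) (hfin : Module.finrank K L = p) [IsGalois K L]
include hp hfin

theorem natCard_aut_eq : Nat.card (L ≃ₐ[K] L) = p := by
  have : FiniteDimensional K L := Module.finite_of_finrank_pos (hfin ▸ hp.pos)
  rw [IsGalois.card_aut_eq_finrank, hfin]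

theorem exists_pow_eq {σ : L ≃ₐ[K] L} (hσ : σ ≠ 1) (τ : L ≃ₐ[K] L) : ∃ k : ℕ, σ ^ k = τ :=
  have : Fact p.Prime := ⟨hp⟩
  mem_powers_of_prime_card (natCard_aut_eq hp hfin) hσ

theorem exists_aut_ne_one : ∃ σ : L ≃ₐ[K] L, σ ≠ 1 := by
  have hc := natCard_aut_eq hp hfin
  have : Finite (L ≃ₐ[K] L) := Nat.finite_of_card_ne_zero (hc ▸ hp.ne_zero)
  have : Nontrivial (L ≃ₐ[K] L) := Finite.one_lt_card_iff_nontrivial.1 (hc ▸ hp.one_lt)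
  exact exists_ne 1

theorem algebraMap_trace_eq_sum_pow {σ : L ≃ₐ[K] L} (hσ : σ ≠ 1) (x : L) :
    algebraMap K L (Algebra.trace K L x) = ∑ i ∈ Finset.range p, (σ ^ i) x := by
  have : FiniteDimensional K L := Module.finite_of_finrank_pos (hfin ▸ hp.pos)
  have : Fact p.Prime := ⟨hp⟩
  have hc := natCard_aut_eq hp hfin
  have ho : orderOf σ = p := orderOf_eq_prime (hc ▸ pow_card_eq_one') hσ
  rw [trace_eq_sum_automorphisms]
  symm
  refine Finset.sum_bij (fun i _ => σ ^ i) (by simp) ?_ ?_ (by simp)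
  · intro i hi j hj hij
    rw [Finset.mem_range] at hi hj
    exact pow_injOn_Iio_orderOf (by simpa [ho] using hi) (by simpa [ho] using hj) hij
  · intro τ _
    obtain ⟨k, rfl⟩ := exists_pow_eq hp hfin hσ τ
    refine ⟨k % p, by simpa using Nat.mod_lt _ hp.pos, ?_⟩
    rw [← ho, pow_mod_orderOf]

theorem algebraMap_trace_eq_sum_choose {σ : L ≃ₐ[K] L} (hσ : σ ≠ 1) (x : L) :
    algebraMap K L (Algebra.trace K L x) =
      ∑ k ∈ Finset.range p, (p.choose (k + 1) : L) * (differenceOp σ ^ k) x := by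
  rw [algebraMap_trace_eq_sum_pow hp hfin hσ, sum_pow_eq_sum_choose_mul_differenceOp]

theorem apply_ne_self {σ : L ≃ₐ[K] L} (hσ : σ ≠ 1) {b : L} (hb : b ∉ Set.range (algebraMap K L)) :
    σ b ≠ b := by
  have : FiniteDimensional K L := Module.finite_of_finrank_pos (hfin ▸ hp.pos)
  intro h
  refine hb ((IsGalois.mem_range_algebraMap_iff_fixed b).2 fun τ => ?_)
  obtain ⟨k, rfl⟩ := exists_pow_eq hp hfin hσ τ
  induction k with
  | zero => simp
  | succ k ih => rw [pow_succ, AlgEquiv.mul_apply, h, ih]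

omit [IsGalois K L] in
theorem exists_notMem_range : ∃ b : L, b ∉ Set.range (algebraMap K L) := by
  by_contra! h
  have h1 : Module.finrank K L = 1 := Module.finrank_of_bijective_algebraMap
    ⟨(algebraMap K L).injective, h⟩
  exact hp.one_lt.ne (h1.symm.trans hfin)

/-- Euler's formula `Tr(b^(p-1)/f'(b)) = 1`, where `f` is the minimal polynomial of `b`. -/
theorem trace_pow_div_prod_sub [Fintype (L ≃ₐ[K] L)] [DecidableEq (L ≃ₐ[K] L)] {b : L}
    (hb : b ∉ Set.range (algebraMap K L)) :
    Algebra.trace K L (b ^ (p - 1) / ∏ τ ∈ Finset.univ.erase (1 : L ≃ₐ[K] L), (b - τ b)) = 1 := by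
  have : FiniteDimensional K L := Module.finite_of_finrank_pos (hfin ▸ hp.pos)
  have hc : (Finset.univ : Finset (L ≃ₐ[K] L)).card = p := by
    rw [Finset.card_univ, ← Nat.card_eq_fintype_card, natCard_aut_eq hp hfin]
  -- The conjugates of `b` are distinct because no nontrivial automorphism fixes `b`; they serve as
  -- interpolation nodes.
  have hinj : Set.InjOn (fun τ : L ≃ₐ[K] L => τ b)
      ((Finset.univ : Finset (L ≃ₐ[K] L)) : Set (L ≃ₐ[K] L)) := by
    intro τ _ ρ _ h
    by_contra hne
    refine apply_ne_self hp hfin (σ := ρ⁻¹ * τ) ?_ hb ?_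
    · rw [Ne, inv_mul_eq_one]
      exact fun h => hne h.symm
    · have h' : τ b = ρ b := h
      rw [AlgEquiv.mul_apply, h', ← AlgEquiv.mul_apply, inv_mul_cancel, AlgEquiv.one_apply]
  -- Interpolating `X^(p-1)` at the `p` conjugates of `b` and comparing leading coefficients writes
  -- 1 as the sum of the conjugates of `b^(p-1)/f'(b)`.
  have h := Lagrange.coeff_eq_sum hinj (P := (Polynomial.X : Polynomial L) ^ (p - 1)) (by
    rw [Polynomial.degree_X_pow, hc]
    exact_mod_cast Nat.sub_lt hp.pos one_pos)
  rw [hc, Polynomial.coeff_X_pow_self] at h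
  refine (algebraMap K L).injective ?_
  rw [trace_eq_sum_automorphisms, map_one, h]
  refine Finset.sum_congr (by congr!) fun τ _ => ?_
  rw [map_div₀, map_pow, map_prod, Polynomial.eval_pow, Polynomial.eval_X]
  congr 1
  refine Finset.prod_bij (fun ρ _ => τ * ρ) ?_ ?_ ?_ ?_
  · intro ρ hρ
    simpa using hρ
  · intro ρ _ ρ' _ h
    exact mul_left_cancel h
  · intro ρ hρ
    refine ⟨τ⁻¹ * ρ, ?_, by simp⟩
    simp only [Finset.mem_erase, Finset.mem_univ, and_true] at hρ ⊢
    rw [Ne, inv_mul_eq_one]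
    exact fun h => hρ h.symm
  · intro ρ _
    rw [map_sub, AlgEquiv.mul_apply]

end Trace

/-! ### Immediacy of the extension and invariance of the valuation -/

section Defect

variable {K L Γ : Type*} [Field K] [Field L] [Algebra K L]
  [AddCommGroup Γ] [LinearOrder Γ] [IsOrderedAddMonoid Γ]
  {v : AddValuation L (WithTop Γ)} {p : ℕ}

theorem restrict_apply (v : AddValuation L (WithTop Γ)) (a : K) :
    restrict K v a = v (algebraMap K L a) := rfl

theorem IsGaloisDefectExtension.ramificationIndex_eq_one_and_residueDegree_eq_one
    (hE : IsGaloisDefectExtension K v p) :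
    ramificationIndex K v = 1 ∧ residueDegree K v = 1 := by
  obtain ⟨d, ⟨-, hd⟩, h1⟩ := hE.defect
  rw [hE.finrank_eq, mul_assoc] at hd
  rcases hE.prime.eq_one_or_self_of_dvd d ⟨_, hd⟩ with h | h
  · exact absurd h h1.ne'
  · subst h
    have := Nat.eq_of_mul_eq_mul_left hE.prime.pos (hd.symm.trans (mul_one d).symm)
    exact mul_eq_one.1 this

theorem IsGaloisDefectExtension.surjective_restrict (hE : IsGaloisDefectExtension K v p)
    (hv : Function.Surjective v) : Function.Surjective (restrict K v) := by
  have h : valueGroup v ≤ valueGroup (restrict K v) :=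
    AddSubgroup.relIndex_eq_one.1 hE.ramificationIndex_eq_one_and_residueDegree_eq_one.1
  intro γ
  induction γ using WithTop.recTopCoe with
  | top => exact ⟨0, by simp⟩
  | coe γ => exact h (hv γ)

/-- Equality of value groups scales `b` to a unit by some `d ∈ K`; equality of residue fields then
approximates this unit by an element of `K`. -/
theorem IsGaloisDefectExtension.exists_lt_val_sub (hE : IsGaloisDefectExtension K v p)
    (hv : Function.Surjective v) {b : L} (hb : b ≠ 0) :
    ∃ c : K, v b < v (b - algebraMap K L c) := by
  obtain ⟨d, hd⟩ := hE.surjective_restrict hv (v b)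
  rw [restrict_apply] at hd
  obtain ⟨β, hβ⟩ := exists_coe_eq_of_ne_zero v hb
  rw [hβ] at hd
  have hd0 := ne_zero_of_eq_coe v hd
  have hu : v (b / algebraMap K L d) = 0 := by rw [val_div_eq v hβ hd, sub_self, WithTop.coe_zero]
  have hsurj : Function.Surjective (IsLocalRing.ResidueField.map (valRingMap K v)) := by
    let : Algebra (residueField (valRing (restrict K v))) (residueField (valRing v)) :=
      (IsLocalRing.ResidueField.map (valRingMap K v)).toAlgebra
    exact (Algebra.finrank_eq_one_iff_bijective_algebraMap.1
      hE.ramificationIndex_eq_one_and_residueDegree_eq_one.2).2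
  obtain ⟨r, hr⟩ := hsurj (IsLocalRing.residue _ ⟨b / algebraMap K L d, hu.ge⟩)
  obtain ⟨c, rfl⟩ := IsLocalRing.residue_surjective r
  rw [IsLocalRing.ResidueField.map_residue, eq_comm, ← sub_eq_zero, ← map_sub,
    IsLocalRing.residue_eq_zero_iff] at hr
  have hlt : 0 < v (b / algebraMap K L d - algebraMap K L c.1) :=
    (mem_maxIdeal_valRing v).1 ⟨_, hr, rfl⟩
  refine ⟨c.1 * d, ?_⟩
  have hbc : b - algebraMap K L (c.1 * d) =
      algebraMap K L d * (b / algebraMap K L d - algebraMap K L c.1) := by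
    rw [map_mul]
    field_simp
  rw [hbc, AddValuation.map_mul, hd, hβ]
  simpa using WithTop.add_lt_add_left (WithTop.coe_ne_top (a := β)) hlt

theorem IsGaloisDefectExtension.zero_le_val_apply (hE : IsGaloisDefectExtension K v p)
    (σ : L ≃ₐ[K] L) {a : L} (ha : 0 ≤ v a) : 0 ≤ v (σ a) := by
  -- The preimage of `𝒪_L` under `σ` again lies over `𝒪_K`, hence equals `𝒪_L`.
  have h := hE.unibranched ((valRing v).comap (σ : L →+* L)) (by
    ext a
    change 0 ≤ v (σ (algebraMap K L a)) ↔ 0 ≤ v (algebraMap K L a)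
    rw [AlgEquiv.commutes])
  have : a ∈ (valRing v).comap (σ : L →+* L) := by
    rw [h]
    exact ha
  exact this

theorem IsGaloisDefectExtension.val_apply (hE : IsGaloisDefectExtension K v p)
    (hv : Function.Surjective v) (σ : L ≃ₐ[K] L) (a : L) : v (σ a) = v a := by
  have key : ∀ (τ : L ≃ₐ[K] L) (x : L), v x ≤ v (τ x) := by
    intro τ x
    by_cases hx : x = 0
    · simp [hx]
    obtain ⟨ξ, hξ⟩ := exists_coe_eq_of_ne_zero v hx
    obtain ⟨d, hd⟩ := hE.surjective_restrict hv (v x)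
    rw [restrict_apply] at hd
    have hd0 : algebraMap K L d ≠ 0 := ne_zero_of_eq_coe v (hd.trans hξ)
    have h := hE.zero_le_val_apply τ (zero_le_val_div v hd0 hd.le)
    have : τ x = τ (x / algebraMap K L d) * algebraMap K L d := by
      rw [map_div₀, AlgEquiv.commutes, div_mul_cancel₀ _ hd0]
    rw [this, AddValuation.map_mul, hd]
    exact le_add_of_nonneg_left h
  refine le_antisymm ?_ (key σ a)
  simpa using key σ⁻¹ (σ a)

theorem IsGaloisDefectExtension.val_le_val_differenceOp (hE : IsGaloisDefectExtension K v p)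
    (hv : Function.Surjective v) (σ : L ≃ₐ[K] L) (a : L) : v a ≤ v (differenceOp σ a) :=
  AddValuation.map_le_sub v (hE.val_apply hv σ a).ge le_rfl

/-- Strictness comes from replacing `a` by `a - c` of larger value, with `c ∈ K` invisible to `σ -
1`. -/
theorem IsGaloisDefectExtension.val_lt_val_differenceOp (hE : IsGaloisDefectExtension K v p)
    (hv : Function.Surjective v) (σ : L ≃ₐ[K] L) {a : L} (ha : a ≠ 0) :
    v a < v (differenceOp σ a) := by
  obtain ⟨c, hc⟩ := hE.exists_lt_val_sub hv ha
  refine hc.trans_le ((hE.val_le_val_differenceOp hv σ _).trans_eq ?_)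
  simp [differenceOp_apply]

theorem IsGaloisDefectExtension.val_lt_val_differenceOp_pow (hE : IsGaloisDefectExtension K v p)
    (hv : Function.Surjective v) (σ : L ≃ₐ[K] L) {a : L} (ha : a ≠ 0) (n : ℕ) :
    v a < v ((differenceOp σ ^ (n + 1)) a) := by
  induction n with
  | zero => simpa using hE.val_lt_val_differenceOp hv σ ha
  | succ n ih =>
    rw [pow_succ', Module.End.mul_apply]
    exact ih.trans_le (hE.val_le_val_differenceOp hv σ _)

theorem IsGaloisDefectExtension.val_pow_apply_sub (hE : IsGaloisDefectExtension K v p)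
    (hv : Function.Surjective v) (σ : L ≃ₐ[K] L) (n : ℕ) (a : L) :
    v (σ a - a) ≤ v ((σ ^ n) a - a) := by
  induction n with
  | zero => simp
  | succ n ih =>
    have : (σ ^ (n + 1)) a - a = (σ ^ n) (σ a - a) + ((σ ^ n) a - a) := by
      rw [pow_succ, AlgEquiv.mul_apply, map_sub]
      ring
    rw [this]
    exact AddValuation.map_le_add v (hE.val_apply hv _ _).ge ih

/-- In a group of prime order `σ` and `τ` are powers of each other, so `val_pow_apply_sub` applies
in both directions. -/
theorem IsGaloisDefectExtension.val_apply_sub_eq (hE : IsGaloisDefectExtension K v p)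
    (hv : Function.Surjective v) {σ τ : L ≃ₐ[K] L} (hσ : σ ≠ 1) (hτ : τ ≠ 1) (a : L) :
    v (τ a - a) = v (σ a - a) := by
  have := hE.isGalois
  obtain ⟨m, hm⟩ := exists_pow_eq hE.prime hE.finrank_eq hσ τ
  obtain ⟨n, hn⟩ := exists_pow_eq hE.prime hE.finrank_eq hτ σ
  refine le_antisymm ?_ ?_
  · conv_rhs => rw [← hn]
    exact hE.val_pow_apply_sub hv τ n a
  · conv_rhs => rw [← hm]
    exact hE.val_pow_apply_sub hv σ m a

/-! ### The set `Σ_ℰ` -/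

theorem IsGaloisDefectExtension.sigmaSet_subset (hE : IsGaloisDefectExtension K v p)
    (hv : Function.Surjective v) {σ τ : L ≃ₐ[K] L} (hσ : σ ≠ 1) (hτ : τ ≠ 1) :
    sigmaSet v σ ⊆ sigmaSet v τ := by
  rintro γ ⟨b, hb, h⟩
  refine ⟨b, hb, ?_⟩
  rw [div_eq_mul_inv, AddValuation.map_mul] at h ⊢
  rw [hE.val_apply_sub_eq hv hσ hτ, h]

theorem IsGaloisDefectExtension.sigmaSet_eq (hE : IsGaloisDefectExtension K v p)
    (hv : Function.Surjective v) {σ : L ≃ₐ[K] L} (hσ : σ ≠ 1) :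
    sigmaSet v σ = SigmaE K v := by
  refine subset_antisymm (Set.subset_iUnion₂_of_subset σ hσ subset_rfl) ?_
  exact Set.iUnion₂_subset fun τ hτ => hE.sigmaSet_subset hv hτ hσ

theorem IsGaloisDefectExtension.exists_sigma (hE : IsGaloisDefectExtension K v p) :
    ∃ σ : L ≃ₐ[K] L, σ ≠ 1 :=
  have := hE.isGalois
  exists_aut_ne_one hE.prime hE.finrank_eq

theorem IsGaloisDefectExtension.mem_SigmaE_iff (hE : IsGaloisDefectExtension K v p)
    (hv : Function.Surjective v) {σ : L ≃ₐ[K] L} (hσ : σ ≠ 1) {γ : Γ} :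
    γ ∈ SigmaE K v ↔
      ∃ (b : L) (β : Γ), v b = β ∧ v (differenceOp σ b) = ((γ + β : Γ) : WithTop Γ) := by
  rw [← hE.sigmaSet_eq hv hσ]
  constructor
  · rintro ⟨b, hb, h⟩
    obtain ⟨β, hβ⟩ := exists_coe_eq_of_ne_zero v hb
    refine ⟨b, β, hβ, ?_⟩
    rw [WithTop.coe_add, ← h, ← hβ, ← AddValuation.map_mul, div_mul_cancel₀ _ hb,
      differenceOp_apply]
  · rintro ⟨b, β, hβ, h⟩
    refine ⟨b, ne_zero_of_eq_coe v hβ, ?_⟩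
    rw [← differenceOp_apply, val_div_eq v h hβ, add_sub_cancel_right]

theorem IsGaloisDefectExtension.SigmaE_nonempty (hE : IsGaloisDefectExtension K v p)
    (hv : Function.Surjective v) : (SigmaE K v).Nonempty := by
  have := hE.isGalois
  obtain ⟨σ, hσ⟩ := hE.exists_sigma
  obtain ⟨b, hb⟩ := exists_notMem_range hE.prime hE.finrank_eq
  obtain ⟨β, hβ⟩ := exists_coe_eq_of_ne_zero v (a := b) (by rintro rfl; exact hb ⟨0, map_zero _⟩)
  obtain ⟨δ, hδ⟩ := exists_coe_eq_of_ne_zero v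
    (sub_ne_zero.2 (apply_ne_self hE.prime hE.finrank_eq hσ hb))
  exact ⟨δ - β, (hE.mem_SigmaE_iff hv hσ).2 ⟨b, β, hβ, by rw [differenceOp_apply, hδ]; simp⟩⟩

theorem IsGaloisDefectExtension.pos_of_mem_SigmaE (hE : IsGaloisDefectExtension K v p)
    (hv : Function.Surjective v) {γ : Γ} (hγ : γ ∈ SigmaE K v) : 0 < γ := by
  obtain ⟨σ, hσ⟩ := hE.exists_sigma
  obtain ⟨b, β, hβ, h⟩ := (hE.mem_SigmaE_iff hv hσ).1 hγ
  have := hE.val_lt_val_differenceOp hv σ (ne_zero_of_eq_coe v hβ)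
  rw [hβ, h, WithTop.coe_lt_coe] at this
  simpa using this

theorem IsGaloisDefectExtension.exists_lt_mem_SigmaE (hE : IsGaloisDefectExtension K v p)
    (hv : Function.Surjective v) {γ : Γ} (hγ : γ ∈ SigmaE K v) : ∃ δ ∈ SigmaE K v, δ < γ := by
  obtain ⟨σ, hσ⟩ := hE.exists_sigma
  obtain ⟨b, β, hβ, h⟩ := (hE.mem_SigmaE_iff hv hσ).1 hγ
  -- Passing from `b` to `b - c` raises the value of the denominator and keeps the numerator.
  obtain ⟨c, hc⟩ := hE.exists_lt_val_sub hv (ne_zero_of_eq_coe v hβ)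
  have hd : differenceOp σ (b - algebraMap K L c) = differenceOp σ b := by
    simp [differenceOp_apply]
  have hne : b - algebraMap K L c ≠ 0 := by
    intro h0
    rw [h0, map_zero] at hd
    exact ne_zero_of_eq_coe v h hd.symm
  obtain ⟨β', hβ'⟩ := exists_coe_eq_of_ne_zero v hne
  rw [hβ, hβ', WithTop.coe_lt_coe] at hc
  refine ⟨γ + β - β', (hE.mem_SigmaE_iff hv hσ).2 ⟨_, β', hβ', ?_⟩, ?_⟩
  · rw [hd, h, sub_add_cancel]
  · rw [sub_lt_iff_lt_add]
    exact add_lt_add_right hc γ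

theorem IsGaloisDefectExtension.mem_SigmaE_of_le (hE : IsGaloisDefectExtension K v p)
    (hv : Function.Surjective v) {γ δ : Γ} (hγ : γ ∈ SigmaE K v) (h : γ ≤ δ) :
    δ ∈ SigmaE K v := by
  rcases h.eq_or_lt with rfl | hlt
  · exact hγ
  obtain ⟨σ, hσ⟩ := hE.exists_sigma
  obtain ⟨b, β, hβ, hb⟩ := (hE.mem_SigmaE_iff hv hσ).1 hγ
  -- Adding `c ∈ K` of this value, which is below `β`, lowers the value of the denominator by
  -- exactly `δ - γ`.
  obtain ⟨c, hc⟩ := hE.surjective_restrict hv ((γ + β - δ : Γ) : WithTop Γ)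
  rw [restrict_apply] at hc
  refine (hE.mem_SigmaE_iff hv hσ).2 ⟨algebraMap K L c + b, γ + β - δ, ?_, ?_⟩
  · rw [AddValuation.map_add_eq_of_lt_left v, hc]
    rw [hc, hβ, WithTop.coe_lt_coe, sub_lt_iff_lt_add, add_comm]
    exact add_lt_add_right hlt β
  · have : differenceOp σ (algebraMap K L c + b) = differenceOp σ b := by
      simp [differenceOp_apply]
    rw [this, hb, add_sub_cancel]

/-- Each application of `σ - 1` either gives 0 or adds an element of `Σ_ℰ` to the value; the
smallest of these increments serves for all of them. -/
theorem IsGaloisDefectExtension.exists_nsmul_add_le_val_differenceOp_pow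
    (hE : IsGaloisDefectExtension K v p) (hv : Function.Surjective v) {σ : L ≃ₐ[K] L}
    (hσ : σ ≠ 1) (n : ℕ) (a : L) :
    ∃ γ ∈ SigmaE K v, ((n • γ : Γ) : WithTop Γ) + v a ≤ v ((differenceOp σ ^ n) a) := by
  induction n with
  | zero =>
    obtain ⟨γ, hγ⟩ := hE.SigmaE_nonempty hv
    exact ⟨γ, hγ, by simp⟩
  | succ n ih =>
    obtain ⟨γ, hγ, hle⟩ := ih
    rw [pow_succ', Module.End.mul_apply]
    set y := (differenceOp σ ^ n) a
    by_cases hy : differenceOp σ y = 0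
    · exact ⟨γ, hγ, by simp [hy]⟩
    have hy0 : y ≠ 0 := by
      intro h
      exact hy (by rw [h, map_zero])
    obtain ⟨β, hβ⟩ := exists_coe_eq_of_ne_zero v hy0
    obtain ⟨ε, hε⟩ := exists_coe_eq_of_ne_zero v hy
    have hδ : ε - β ∈ SigmaE K v :=
      (hE.mem_SigmaE_iff hv hσ).2 ⟨y, β, hβ, by rw [hε, sub_add_cancel]⟩
    have key : ∀ α : Γ, α ≤ γ → α ≤ ε - β →
        (((n + 1) • α : Γ) : WithTop Γ) + v a ≤ v (differenceOp σ y) := by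
      intro α h1 h2
      have e : v (differenceOp σ y) = ((ε - β : Γ) : WithTop Γ) + v y := by
        rw [hε, hβ, ← WithTop.coe_add, sub_add_cancel]
      rw [e, succ_nsmul', WithTop.coe_add, add_assoc]
      exact add_le_add (WithTop.coe_le_coe.2 h2)
        ((add_le_add_left (WithTop.coe_le_coe.2 (nsmul_le_nsmul_right h1 n)) _).trans hle)
    rcases le_total γ (ε - β) with h | h
    · exact ⟨γ, hγ, key γ le_rfl h⟩
    · exact ⟨ε - β, hδ, key _ h le_rfl⟩

/-! ### The trace of the maximal ideal -/

theorem val_natCast_le_of_dvd {m n : ℕ} (h : m ∣ n) : v (m : L) ≤ v (n : L) := by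
  obtain ⟨k, rfl⟩ := h
  rw [Nat.cast_mul, AddValuation.map_mul]
  exact le_add_of_nonneg_right (zero_le_val_natCast v k)

theorem algebraMap_trace_eq_add (hE : IsGaloisDefectExtension K v p) {σ : L ≃ₐ[K] L}
    (hσ : σ ≠ 1) (x : L) :
    algebraMap K L (Algebra.trace K L x) =
      (p : L) * x + ∑ k ∈ Finset.range (p - 2),
        (p.choose (k + 2) : L) * (differenceOp σ ^ (k + 1)) x + (differenceOp σ ^ (p - 1)) x := by
  have := hE.isGalois
  rw [algebraMap_trace_eq_sum_choose hE.prime hE.finrank_eq hσ]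
  -- Writing `p = n + 2` allows both end terms, with coefficients `p` and 1, to be split off; for `p
  -- = 2` the middle sum is empty.
  obtain ⟨n, rfl⟩ := Nat.exists_eq_add_of_le' hE.prime.two_le
  rw [Finset.sum_range_succ, Finset.sum_range_succ', add_comm (Finset.sum _ _)]
  simp

/-- For `b` of trace zero the expansion reads `-D^(p-1) b = p b + ⋯`. The middle terms have value
larger than `v (p b)`, so `D^(p-1)` raises `v b` by exactly `v p`. -/
theorem IsGaloisDefectExtension.exists_nsmul_le_val_natCast (hE : IsGaloisDefectExtension K v p)
    (hv : Function.Surjective v) :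
    ∃ γ ∈ SigmaE K v, (((p - 1) • γ : Γ) : WithTop Γ) ≤ v (p : L) := by
  have := hE.isGalois
  by_cases hp0 : (p : L) = 0
  · obtain ⟨γ, hγ⟩ := hE.SigmaE_nonempty hv
    exact ⟨γ, hγ, by simp [hp0]⟩
  obtain ⟨σ, hσ⟩ := hE.exists_sigma
  obtain ⟨c, hc⟩ := exists_notMem_range hE.prime hE.finrank_eq
  -- Every `σ c - c` has trace zero, and `c ∉ K` makes it nonzero.
  set b := differenceOp σ c
  have hb : b ≠ 0 := sub_ne_zero.2 (apply_ne_self hE.prime hE.finrank_eq hσ hc)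
  have htr : Algebra.trace K L b = 0 := by
    have : FiniteDimensional K L := Module.finite_of_finrank_pos (hE.finrank_eq ▸ hE.prime.pos)
    rw [show b = σ c - c from rfl, map_sub, Algebra.trace_eq_of_algEquiv σ c, sub_self]
  obtain ⟨β, hβ⟩ := exists_coe_eq_of_ne_zero v hb
  obtain ⟨π, hπ⟩ := exists_coe_eq_of_ne_zero v hp0
  have hsum := algebraMap_trace_eq_add hE hσ b
  rw [htr, map_zero, eq_comm, add_eq_zero_iff_neg_eq] at hsum
  have hlt : v ((p : L) * b) < v (∑ k ∈ Finset.range (p - 2),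
      (p.choose (k + 2) : L) * (differenceOp σ ^ (k + 1)) b) := by
    have hpb : v ((p : L) * b) = ((π + β : Γ) : WithTop Γ) := by
      rw [AddValuation.map_mul, hπ, hβ, WithTop.coe_add]
    refine AddValuation.map_lt_sum v (hpb ▸ WithTop.coe_ne_top) fun k hk => ?_
    rw [Finset.mem_range] at hk
    have hdvd : p ∣ p.choose (k + 2) :=
      hE.prime.dvd_choose_self (by lia) (by lia)
    rw [AddValuation.map_mul, AddValuation.map_mul]
    refine (WithTop.add_lt_add_left (hπ ▸ WithTop.coe_ne_top)
      (hE.val_lt_val_differenceOp_pow hv σ hb k)).trans_le ?_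
    exact add_le_add_left (val_natCast_le_of_dvd hdvd) _
  obtain ⟨γ, hγ, hle⟩ := hE.exists_nsmul_add_le_val_differenceOp_pow hv hσ (p - 1) b
  refine ⟨γ, hγ, ?_⟩
  rw [← hsum, AddValuation.map_neg, AddValuation.map_add_eq_of_lt_left v hlt,
    AddValuation.map_mul, hβ] at hle
  exact (WithTop.add_le_add_iff_right WithTop.coe_ne_top).1 hle

theorem IsGaloisDefectExtension.exists_nsmul_le_val_trace (hE : IsGaloisDefectExtension K v p)
    (hv : Function.Surjective v) {a : L} (ha : 0 ≤ v a) :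
    ∃ γ ∈ SigmaE K v, (((p - 1) • γ : Γ) : WithTop Γ) ≤ restrict K v (Algebra.trace K L a) := by
  obtain ⟨σ, hσ⟩ := hE.exists_sigma
  obtain ⟨γ, hγ, hpγ⟩ := hE.exists_nsmul_le_val_natCast hv
  obtain ⟨δ, hδ, haδ⟩ := hE.exists_nsmul_add_le_val_differenceOp_pow hv hσ (p - 1) a
  have key : ∀ ε : Γ, ε ≤ γ → ε ≤ δ →
      (((p - 1) • ε : Γ) : WithTop Γ) ≤ restrict K v (Algebra.trace K L a) := by
    intro ε h1 h2
    have hεp : (((p - 1) • ε : Γ) : WithTop Γ) ≤ v (p : L) :=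
      (WithTop.coe_le_coe.2 (nsmul_le_nsmul_right h1 _)).trans hpγ
    rw [restrict_apply, algebraMap_trace_eq_add hE hσ]
    refine AddValuation.map_le_add v (AddValuation.map_le_add v ?_ ?_) ?_
    · rw [AddValuation.map_mul]
      exact hεp.trans (le_add_of_nonneg_right ha)
    · refine AddValuation.map_le_sum v fun k hk => ?_
      rw [Finset.mem_range] at hk
      have hdvd : p ∣ p.choose (k + 2) :=
        hE.prime.dvd_choose_self (by lia) (by lia)
      rw [AddValuation.map_mul]
      refine (hεp.trans (val_natCast_le_of_dvd hdvd)).trans (le_add_of_nonneg_right ?_)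
      by_cases ha0 : a = 0
      · simp [ha0]
      · exact ha.trans (hE.val_lt_val_differenceOp_pow hv σ ha0 k).le
    · exact (WithTop.coe_le_coe.2 (nsmul_le_nsmul_right h2 _)).trans
        ((le_add_of_nonneg_right ha).trans haδ)
  rcases le_total γ δ with h | h
  · exact ⟨γ, hγ, key γ le_rfl h⟩
  · exact ⟨δ, hδ, key δ h le_rfl⟩

theorem val_prod_eq_card_nsmul {ι : Type*} (s : Finset ι) (f : ι → L) {γ : Γ}
    (h : ∀ i ∈ s, v (f i) = γ) : v (∏ i ∈ s, f i) = ((s.card • γ : Γ) : WithTop Γ) := by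
  classical
  induction s using Finset.induction_on with
  | empty => simp
  | insert i s hi ih =>
    rw [Finset.prod_insert hi, AddValuation.map_mul, h i (Finset.mem_insert_self _ _),
      ih fun j hj => h j (Finset.mem_insert_of_mem hj), Finset.card_insert_of_notMem hi,
      succ_nsmul', WithTop.coe_add]

/-- In Euler's formula for a `b` realising `γ`, all `p - 1` factors `b - τ b` have the same value `γ
+ v b`. -/
theorem IsGaloisDefectExtension.exists_trace_eq_one (hE : IsGaloisDefectExtension K v p)
    (hv : Function.Surjective v) {γ : Γ} (hγ : γ ∈ SigmaE K v) :
    ∃ y : L, Algebra.trace K L y = 1 ∧ v y = ((-((p - 1) • γ) : Γ) : WithTop Γ) := by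
  classical
  have := hE.isGalois
  have : FiniteDimensional K L := Module.finite_of_finrank_pos (hE.finrank_eq ▸ hE.prime.pos)
  obtain ⟨σ, hσ⟩ := hE.exists_sigma
  obtain ⟨b, β, hβ, h⟩ := (hE.mem_SigmaE_iff hv hσ).1 hγ
  have hb : b ∉ Set.range (algebraMap K L) := by
    rintro ⟨c, rfl⟩
    refine ne_zero_of_eq_coe v h ?_
    simp [differenceOp_apply]
  refine ⟨_, trace_pow_div_prod_sub hE.prime hE.finrank_eq hb, ?_⟩
  have hprod := val_prod_eq_card_nsmul (v := v) (Finset.univ.erase (1 : L ≃ₐ[K] L))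
    (fun τ => b - τ b) (γ := γ + β) (by
      intro τ hτ
      rw [AddValuation.map_sub_swap, hE.val_apply_sub_eq hv hσ (Finset.ne_of_mem_erase hτ)]
      exact h)
  rw [Finset.card_erase_of_mem (Finset.mem_univ _), Finset.card_univ, ← Nat.card_eq_fintype_card,
    natCard_aut_eq hE.prime hE.finrank_eq] at hprod
  rw [val_div_eq v (val_pow_eq v hβ _) hprod, nsmul_add, sub_add_cancel_right]

theorem IsGaloisDefectExtension.mem_traceMax_iff (hE : IsGaloisDefectExtension K v p)
    (hv : Function.Surjective v) {b : K} :
    b ∈ traceMax K v ↔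
      ∃ γ ∈ SigmaE K v, (((p - 1) • γ : Γ) : WithTop Γ) ≤ restrict K v b := by
  constructor
  · rintro ⟨a, ha, rfl⟩
    exact hE.exists_nsmul_le_val_trace hv ((mem_maxIdeal_valRing v).1 ha).le
  · rintro ⟨γ, hγ, hb⟩
    -- A strictly smaller `δ` is needed to place `b • y` in `ℳ_L` and not merely in `𝒪_L`.
    obtain ⟨δ, hδ, hlt⟩ := hE.exists_lt_mem_SigmaE hv hγ
    obtain ⟨y, hy, hvy⟩ := hE.exists_trace_eq_one hv hδ
    have hp : p - 1 ≠ 0 := (Nat.sub_pos_of_lt hE.prime.one_lt).ne'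
    refine ⟨b • y, (mem_maxIdeal_valRing v).2 ?_, ?_⟩
    · rw [Algebra.smul_def, AddValuation.map_mul, hvy]
      have h1 : (((p - 1) • δ : Γ) : WithTop Γ) < v (algebraMap K L b) :=
        (WithTop.coe_lt_coe.2 (nsmul_lt_nsmul_right hp hlt)).trans_le hb
      have h2 := WithTop.add_lt_add_right (WithTop.coe_ne_top (a := -((p - 1) • δ))) h1
      rwa [← WithTop.coe_add, add_neg_cancel, WithTop.coe_zero] at h2
    · change Algebra.trace K L (b • y) = b
      rw [map_smul, hy, smul_eq_mul, mul_one]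

/-! ### Independent defect and the coarsening by `H` -/

theorem mem_coarseMaxInter {H : AddSubgroup Γ} {b : K} :
    b ∈ coarseMaxInter K v H ↔ ∀ h ∈ H, (h : WithTop Γ) < restrict K v b :=
  mem_maxIdeal_coarsening v

theorem coarseMaxInter_bot :
    coarseMaxInter K v ⊥ = maxIdeal (valRing (restrict K v)) := by
  ext b
  rw [mem_coarseMaxInter, mem_maxIdeal_valRing]
  simp

omit [IsOrderedAddMonoid Γ] in
theorem coe_lt_iff_exists_mem_above {H : AddSubgroup Γ} (hne : (above H).Nonempty)
    {x : WithTop Γ} :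
    (∀ h ∈ H, (h : WithTop Γ) < x) ↔ ∃ α ∈ above H, (α : WithTop Γ) ≤ x := by
  constructor
  · intro h
    induction x using WithTop.recTopCoe with
    -- The value `∞` is not in `Γ`, so a witness must come from `hne`.
    | top => exact hne.imp fun α hα => ⟨hα, le_top⟩
    | coe x => exact ⟨x, fun β hβ => WithTop.coe_lt_coe.1 (h β hβ), le_rfl⟩
  · rintro ⟨α, hα, hle⟩ h hh
    exact (WithTop.coe_lt_coe.2 (hα h hh)).trans_le hle

/-- Here `H` may be any subgroup: for `H = {0}` strong convexity is only deduced afterwards, in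
`isStronglyConvex_bot`. -/
theorem IsGaloisDefectExtension.SigmaE_eq_above (hE : IsGaloisDefectExtension K v p)
    (hv : Function.Surjective v) {H : AddSubgroup Γ}
    (h : traceMax K v = coarseMaxInter K v H) : SigmaE K v = above H := by
  have hp : p - 1 ≠ 0 := (Nat.sub_pos_of_lt hE.prime.one_lt).ne'
  -- Since `vK = Γ`, the equality of subsets of `K` becomes a statement about all `β` in `Γ`.
  have key : ∀ β : Γ, (∃ γ ∈ SigmaE K v, (p - 1) • γ ≤ β) ↔ β ∈ above H := by
    intro β
    obtain ⟨b, hb⟩ := hE.surjective_restrict hv β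
    have := Set.ext_iff.1 h b
    rw [hE.mem_traceMax_iff hv, mem_coarseMaxInter, hb] at this
    simp only [WithTop.coe_le_coe, WithTop.coe_lt_coe] at this
    exact this
  ext α
  constructor
  · intro hα
    exact mem_above_of_nsmul_mem ((key _).1 ⟨α, hα, le_rfl⟩)
  · intro hα
    obtain ⟨γ, hγ, hle⟩ := (key _).2 (nsmul_mem_above hα hp)
    exact hE.mem_SigmaE_of_le hv hγ (le_of_nsmul_le_nsmul_right hp hle)

theorem IsGaloisDefectExtension.traceMax_eq_coarseMaxInter (hE : IsGaloisDefectExtension K v p)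
    (hv : Function.Surjective v) {H : AddSubgroup Γ}
    (h : HasIndependentDefectWith K v H) : traceMax K v = coarseMaxInter K v H := by
  have hp : p - 1 ≠ 0 := (Nat.sub_pos_of_lt hE.prime.one_lt).ne'
  obtain ⟨hH, hS⟩ := h
  ext b
  rw [hE.mem_traceMax_iff hv, mem_coarseMaxInter, coe_lt_iff_exists_mem_above hH.above_nonempty, hS]
  constructor
  · rintro ⟨γ, hγ, hle⟩
    exact ⟨_, nsmul_mem_above hγ hp, hle⟩
  · rintro ⟨α, hα, hle⟩
    -- This is where it matters that `Γ/H` has no smallest positive element.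
    obtain ⟨γ, hγ, hle'⟩ := hH.exists_nsmul_le (p - 1) hα
    exact ⟨γ, hγ, (WithTop.coe_le_coe.2 hle').trans hle⟩

theorem IsGaloisDefectExtension.hasIndependentDefectWith_iff (hE : IsGaloisDefectExtension K v p)
    (hv : Function.Surjective v) {H : AddSubgroup Γ} :
    HasIndependentDefectWith K v H ↔
      IsStronglyConvex H ∧ traceMax K v = coarseMaxInter K v H :=
  ⟨fun h => ⟨h.1, hE.traceMax_eq_coarseMaxInter hv h⟩,
    fun h => ⟨h.1, hE.SigmaE_eq_above hv h.2⟩⟩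

theorem IsGaloisDefectExtension.isStronglyConvex_bot (hE : IsGaloisDefectExtension K v p)
    (hv : Function.Surjective v) (h : SigmaE K v = above ⊥) :
    IsStronglyConvex (⊥ : AddSubgroup Γ) where
  proper := by
    intro htop
    obtain ⟨γ, hγ⟩ := hE.SigmaE_nonempty hv
    have h0 : γ ∈ (⊥ : AddSubgroup Γ) := htop ▸ AddSubgroup.mem_top γ
    exact (hE.pos_of_mem_SigmaE hv hγ).ne' h0
  convex := by
    rw [AddSubgroup.coe_bot]
    exact Set.ordConnected_singleton
  no_least := by
    rintro ⟨α, hα, hmin⟩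
    rw [← h] at hα hmin
    obtain ⟨δ, hδ, hlt⟩ := hE.exists_lt_mem_SigmaE hv hα
    obtain ⟨k, hk, hle⟩ := hmin δ hδ
    rw [AddSubgroup.mem_bot] at hk
    rw [hk, add_zero] at hle
    exact hlt.not_ge hle

theorem IsGaloisDefectExtension.hasIndependentDefectWith_bot_iff
    (hE : IsGaloisDefectExtension K v p) (hv : Function.Surjective v) :
    HasIndependentDefectWith K v ⊥ ↔ traceMax K v = maxIdeal (valRing (restrict K v)) := by
  rw [← coarseMaxInter_bot, hE.hasIndependentDefectWith_iff hv]
  exact ⟨fun h => h.2, fun h => ⟨hE.isStronglyConvex_bot hv (hE.SigmaE_eq_above hv h), h⟩⟩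

theorem IsGaloisDefectExtension.coe_lt_val_natCast (hE : IsGaloisDefectExtension K v p)
    (hv : Function.Surjective v) {H : AddSubgroup Γ} (hS : SigmaE K v = above H) :
    ∀ h ∈ H, (h : WithTop Γ) < v (p : L) := by
  have hp : p - 1 ≠ 0 := (Nat.sub_pos_of_lt hE.prime.one_lt).ne'
  obtain ⟨γ, hγ, hle⟩ := hE.exists_nsmul_le_val_natCast hv
  rw [hS] at hγ
  exact fun h hh => (WithTop.coe_lt_coe.2 (nsmul_mem_above hγ hp h hh)).trans_le hle

/-! ### Archimedean value groups and residue characteristic -/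

theorem eq_bot_of_archimedean (hv : Function.Surjective (restrict K v))
    (harch : Archimedean (valueGroup (restrict K v))) {H : AddSubgroup Γ}
    (hne : (above H).Nonempty) : H = ⊥ := by
  obtain ⟨α, hα⟩ := hne
  have key : ∀ h ∈ H, ¬ 0 < h := by
    intro h hh h0
    obtain ⟨n, hn⟩ := harch.arch (⟨α, hv α⟩ : valueGroup (restrict K v))
      (y := ⟨h, hv h⟩) h0
    exact (hα _ (H.nsmul_mem hh n)).not_ge hn
  refine (AddSubgroup.eq_bot_iff_forall H).2 fun h hh => ?_
  refine le_antisymm (not_lt.1 (key h hh)) ?_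
  simpa using key (-h) (H.neg_mem hh)

/-- In characteristic 0, `H < v p` puts the positive elements of `H` into the convex hull of `v p`,
where a multiple of any of them would reach `v p`. In positive characteristic the hull is all of
`vK`. -/
theorem eq_bot_of_archimedean_convexHullOfValue (hv : Function.Surjective (restrict K v))
    (hp : p ≠ 0) (harch : Archimedean (convexHullOfValue (restrict K v) p)) {H : AddSubgroup Γ}
    (hne : (above H).Nonempty) (hpH : ∀ h ∈ H, (h : WithTop Γ) < v (p : L)) : H = ⊥ := by
  by_cases hchar : ringChar K = 0
  · have : CharP K 0 := hchar ▸ ringChar.charP K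
    have : CharZero K := CharP.charP_to_charZero K
    obtain ⟨π, hπ⟩ := exists_coe_eq_of_ne_zero (restrict K v) (Nat.cast_ne_zero.2 hp : (p : K) ≠ 0)
    have hπ' : v (p : L) = π := by
      rw [← hπ, restrict_apply, map_natCast (algebraMap K L)]
    have hHπ : ∀ h ∈ H, h < π := fun h hh => WithTop.coe_lt_coe.1 (hπ' ▸ hpH h hh)
    rw [convexHullOfValue, if_pos hchar] at harch
    have hmem : ∀ (C : AddSubgroup (valueGroup (restrict K v))),
        ((C : Set (valueGroup (restrict K v))).OrdConnected ∧
          ∀ γ : valueGroup (restrict K v),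
            restrict K v (p : K) = ((γ : Γ) : WithTop Γ) → γ ∈ C) →
        (⟨π, hv π⟩ : valueGroup (restrict K v)) ∈ C := fun C hC => hC.2 _ hπ
    have key : ∀ h ∈ H, ¬ 0 < h := by
      intro h hh h0
      have hhmem : (⟨h, hv h⟩ : valueGroup (restrict K v)) ∈
          sInf {C : AddSubgroup (valueGroup (restrict K v)) |
            (C : Set (valueGroup (restrict K v))).OrdConnected ∧
              ∀ γ : valueGroup (restrict K v),
                restrict K v (p : K) = ((γ : Γ) : WithTop Γ) → γ ∈ C} :=
        AddSubgroup.mem_sInf.2 fun C hC =>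
          mem_of_le_of_le hC.1 (hmem C hC) h0.le (hHπ h hh).le
      obtain ⟨n, hn⟩ := harch.arch ⟨_, AddSubgroup.mem_sInf.2 hmem⟩ (y := ⟨_, hhmem⟩) h0
      exact (hHπ _ (H.nsmul_mem hh n)).not_ge hn
    refine (AddSubgroup.eq_bot_iff_forall H).2 fun h hh => ?_
    refine le_antisymm (not_lt.1 (key h hh)) ?_
    simpa using key (-h) (H.neg_mem hh)
  · rw [convexHullOfValue, if_neg hchar] at harch
    refine eq_bot_of_archimedean hv ⟨fun x y hy => ?_⟩ hne
    obtain ⟨n, hn⟩ := harch.arch ⟨x, AddSubgroup.mem_top x⟩ (y := ⟨y, AddSubgroup.mem_top y⟩) hy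
    exact ⟨n, hn⟩

theorem charP_residueField_coarsening {F : Type*} [Field F] {w : AddValuation F (WithTop Γ)}
    (hp : p.Prime) {H : AddSubgroup Γ} (h : ∀ k ∈ H, (k : WithTop Γ) < w (p : F)) :
    CharP (residueField (coarsening w H)) p := by
  obtain ⟨x, hx, hxp⟩ := (mem_maxIdeal_coarsening w).2 h
  have hx' : x = (p : coarsening w H) := Subtype.ext hxp
  have h0 : ((p : ℕ) : residueField (coarsening w H)) = 0 := by
    rw [← map_natCast (IsLocalRing.residue (coarsening w H)), IsLocalRing.residue_eq_zero_iff,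
      ← hx']
    exact hx
  have hr : ringChar (residueField (coarsening w H)) = p :=
    CharP.ringChar_of_prime_eq_zero hp h0
  exact hr ▸ ringChar.charP _

end Defect

end DefectTrace

theorem theorem1p3 {K L Γ : Type*} [Field K] [Field L] [Algebra K L]
    [AddCommGroup Γ] [LinearOrder Γ] [IsOrderedAddMonoid Γ]
    (v : AddValuation L (WithTop Γ)) (hv : Function.Surjective v)
    (p : ℕ) (hE : DefectTrace.IsGaloisDefectExtension K v p) :
    -- all `Σ_σ` with `σ ≠ id` agree, so `Σ_ℰ` is well defined
    (∀ σ : L ≃ₐ[K] L, σ ≠ 1 → DefectTrace.sigmaSet v σ = DefectTrace.SigmaE K v) ∧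
    -- `Tr(ℳ_L) = (b ∈ K | v b ∈ (p-1)Σ_ℰ) = I_ℰ^(p-1) ∩ K`
    DefectTrace.traceMax K v =
      (DefectTrace.spanOfValues (DefectTrace.restrict K v)
        ((fun α : Γ => (p - 1) • α) '' DefectTrace.SigmaE K v) : Set K) ∧
    (DefectTrace.spanOfValues (DefectTrace.restrict K v)
        ((fun α : Γ => (p - 1) • α) '' DefectTrace.SigmaE K v) : Set K) =
      algebraMap K L ⁻¹' ((DefectTrace.ramificationIdeal K v ^ (p - 1) :
        Submodule (DefectTrace.valRing v) L) : Set L) ∧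
    -- `ℳ_{v_H} ∩ K = (b ∈ K | v b > H)` for all strongly convex `H`
    (∀ H : AddSubgroup Γ, DefectTrace.IsStronglyConvex H →
      DefectTrace.coarseMaxInter K v H =
        (DefectTrace.spanOfValues (DefectTrace.restrict K v) (DefectTrace.above H) : Set K)) ∧
    -- independent defect if and only if `Tr(ℳ_L) = ℳ_{v_H} ∩ K` for some strongly convex `H`
    (DefectTrace.HasIndependentDefect K v ↔
      ∃ H : AddSubgroup Γ, DefectTrace.IsStronglyConvex H ∧
        DefectTrace.traceMax K v = DefectTrace.coarseMaxInter K v H) ∧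
    -- the case `H = {0}`
    (DefectTrace.traceMax K v = DefectTrace.coarseMaxInter K v ⊥ ↔
      DefectTrace.traceMax K v =
        DefectTrace.maxIdeal (DefectTrace.valRing (DefectTrace.restrict K v))) ∧
    (DefectTrace.HasIndependentDefectWith K v ⊥ ↔
      DefectTrace.traceMax K v =
        DefectTrace.maxIdeal (DefectTrace.valRing (DefectTrace.restrict K v))) ∧
    -- `H = {0}` always holds if `vK` or `(vK)_{vp}` is archimedean
    ((Archimedean (DefectTrace.valueGroup (DefectTrace.restrict K v)) ∨
        Archimedean (DefectTrace.convexHullOfValue (DefectTrace.restrict K v) p)) →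
      (∀ H : AddSubgroup Γ, DefectTrace.IsStronglyConvex H →
        DefectTrace.traceMax K v = DefectTrace.coarseMaxInter K v H → H = ⊥) ∧
      (DefectTrace.HasIndependentDefect K v ↔
        DefectTrace.traceMax K v =
          DefectTrace.maxIdeal (DefectTrace.valRing (DefectTrace.restrict K v)))) ∧
    -- mixed characteristic: `p ∈ ℳ_{v_H}` and `char K v_H = p`
    (CharZero K → ∀ H : AddSubgroup Γ, DefectTrace.IsStronglyConvex H →
      DefectTrace.traceMax K v = DefectTrace.coarseMaxInter K v H →
      (p : L) ∈ DefectTrace.maxIdeal (DefectTrace.coarsening v H) ∧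
      CharP (DefectTrace.residueField
        (DefectTrace.coarsening (DefectTrace.restrict K v) H)) p) := by

  have hKv := hE.surjective_restrict hv
  have hne := hE.SigmaE_nonempty hv
  -- All of `Γ` is already attained on `K`, so the span criterion applies over `K` to every set of
  -- values.
  have huniv : ∀ S : Set Γ, S ⊆ DefectTrace.valueGroup (DefectTrace.restrict K v) :=
    fun S γ _ => hKv γ
  have hspan : (DefectTrace.spanOfValues (DefectTrace.restrict K v)
        ((fun α : Γ => (p - 1) • α) '' DefectTrace.SigmaE K v) : Set K) =
      {b | ∃ γ ∈ DefectTrace.SigmaE K v,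
        (((p - 1) • γ : Γ) : WithTop Γ) ≤ DefectTrace.restrict K v b} := by
    ext b
    rw [SetLike.mem_coe, DefectTrace.mem_spanOfValues _ (hne.image _) (huniv _)]
    simp
  have hind : DefectTrace.HasIndependentDefect K v ↔
      ∃ H : AddSubgroup Γ, DefectTrace.IsStronglyConvex H ∧
        DefectTrace.traceMax K v = DefectTrace.coarseMaxInter K v H :=
    exists_congr fun H => hE.hasIndependentDefectWith_iff hv
  have hbot := hE.hasIndependentDefectWith_bot_iff hv
  refine ⟨fun σ hσ => hE.sigmaSet_eq hv hσ, ?_, ?_, ?_, hind, ?_, hbot, ?_, ?_⟩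
  · rw [hspan]
    exact Set.ext fun b => hE.mem_traceMax_iff hv
  · rw [hspan]
    exact Set.ext fun b =>
      (DefectTrace.mem_spanOfValues_pow v hne (fun γ _ => hv γ) (p - 1)).symm
  · intro H hH
    ext b
    rw [SetLike.mem_coe, DefectTrace.mem_coarseMaxInter,
      DefectTrace.mem_spanOfValues _ hH.above_nonempty (huniv _),
      DefectTrace.coe_lt_iff_exists_mem_above hH.above_nonempty]
  · rw [DefectTrace.coarseMaxInter_bot]
  · intro harch
    have hH : ∀ H : AddSubgroup Γ, DefectTrace.IsStronglyConvex H →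
        DefectTrace.traceMax K v = DefectTrace.coarseMaxInter K v H → H = ⊥ := by
      intro H hH htr
      rcases harch with harch | harch
      · exact DefectTrace.eq_bot_of_archimedean hKv harch hH.above_nonempty
      · exact DefectTrace.eq_bot_of_archimedean_convexHullOfValue hKv hE.prime.ne_zero harch
          hH.above_nonempty (hE.coe_lt_val_natCast hv (hE.SigmaE_eq_above hv htr))
    refine ⟨hH, fun h => ?_, fun h => ⟨⊥, hbot.2 h⟩⟩
    obtain ⟨H, hsc, htr⟩ := hind.1 h
    rw [← DefectTrace.coarseMaxInter_bot, ← hH H hsc htr, htr]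
  · intro _ H _ htr
    have hp := hE.coe_lt_val_natCast hv (hE.SigmaE_eq_above hv htr)
    refine ⟨(DefectTrace.mem_maxIdeal_coarsening v).2 hp,
      DefectTrace.charP_residueField_coarsening hE.prime fun k hk => ?_⟩
    rw [DefectTrace.restrict_apply, map_natCast (algebraMap K L)]
    exact hp k hk
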